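/- Let $G$ be a finite commutative group, written additively, let $M\ge 1$ and $q\ge 0$ be integers, and consider the summation problem: given $q$ quantum queries to a uniformly random function $A:\{0,\dots,M-1\}\to G$, output $\sum_{x=0}^{M-1}A(x)$. A $q$-query quantum algorithm has an arbitrary finite-dimensional work register $z$, starts in a unit vector independent of $A$, applies $q$ queries, each followed by an arbitrary unitary independent of $A$, measures in the computational basis, and computes its output from the outcome by a fixed function. A query is either the phase query $|x,\xi,z\rangle\mapsto\xi(A(x))\,|x,\xi,z\rangle$, where $\xi$ ranges over the characters of $G$, or the controlled-add query $|x,g,z\rangle\mapsto|x,g+A(x),z\rangle$. The success probability is taken over the random choice of $A$ and the measurement. Then, in each of the two query models, the maximum success probability of a $q$-query quantum algorithm exists. If $q<M$, it is exactly $$\min\left(\frac{\lfloor M/(M-q)\rfloor}{|G|},\,1\right),$$ and if $q\ge M$, it is $1$. In particular (the known parity bounds), if $|G|=2$, then it is $1/2$ for $q<M/2$ and $1$ for $q\ge M/2$. -/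

import Mathlib

/-!
Quantum query algorithms for a function `A : X → G`, where `X` is a finite set and `G` is a finite
commutative group. Basis states are triples `(x, r, z)`: a query register `x : X`, a response
register `r : R` and a work register `z : Z` of arbitrary finite size.
-/

universe u

noncomputable section

namespace QuantumQuery

/-- Vectors in the Hilbert space with orthonormal basis `|x, r, z⟩`. -/
abbrev StateSpace (X R Z : Type*) [Fintype X] [Fintype R] [Fintype Z] : Type _ :=
  EuclideanSpace ℂ (X × R × Z)

/-- The phase query `|x, ξ, z⟩ ↦ ξ (A x) |x, ξ, z⟩`; the response register holds a character of `G`.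
-/
def phaseQuery {X G Z : Type*} [Fintype X] [AddCommGroup G] [Fintype G] [Fintype Z] (A : X → G) :
    StateSpace X (AddChar G ℂ) Z →ₗ[ℂ] StateSpace X (AddChar G ℂ) Z where
  toFun ψ := WithLp.toLp 2 fun i => i.2.1 (A i.1) * ψ i
  map_add' φ ψ := by ext i; simp [mul_add]
  map_smul' c ψ := by ext i; simp [mul_left_comm]

/-- The controlled-add query `|x, g, z⟩ ↦ |x, g + A x, z⟩`: the amplitude of `|x, g, z⟩` after the
query is the amplitude of `|x, g - A x, z⟩` before it. -/
def addQuery {X G Z : Type*} [Fintype X] [AddCommGroup G] [Fintype G] [Fintype Z] (A : X → G) :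
    StateSpace X G Z →ₗ[ℂ] StateSpace X G Z where
  toFun ψ := WithLp.toLp 2 fun i => ψ (i.1, i.2.1 - A i.1, i.2.2)
  map_add' φ ψ := by ext i; simp
  map_smul' c ψ := by ext i; simp

/-- A quantum query algorithm with outputs in `S`: a unit vector as initial state, a unitary
`gate k` applied right after query number `k` (counted from `0`), and a measurement in the basis
`|x, r, z⟩` whose outcome is decoded by `out`. None of these data depends on the oracle. A run with
`q` queries uses the gates `gate 0, …, gate (q - 1)` only. -/
structure Algorithm (X R Z S : Type*) [Fintype X] [Fintype R] [Fintype Z] where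
  init : StateSpace X R Z
  norm_init : ‖init‖ = 1
  gate : ℕ → (StateSpace X R Z ≃ₗᵢ[ℂ] StateSpace X R Z)
  out : X × R × Z → S

namespace Algorithm

variable {X R Z S : Type*} [Fintype X] [Fintype R] [Fintype Z]

/-- The state after `q` queries, where `O` is the operator performing one query. -/
def state (alg : Algorithm X R Z S) (O : StateSpace X R Z →ₗ[ℂ] StateSpace X R Z) :
    ℕ → StateSpace X R Z
  | 0 => alg.init
  | k + 1 => alg.gate k (O (alg.state O k))

open Classical in
/-- The probability that the algorithm outputs `s` after `q` queries (Born rule). -/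
def outputProb (alg : Algorithm X R Z S) (O : StateSpace X R Z →ₗ[ℂ] StateSpace X R Z) (q : ℕ)
    (s : S) : ℝ :=
  ∑ i : X × R × Z, if alg.out i = s then ‖alg.state O q i‖ ^ 2 else 0

open Classical in
/-- The probability that the algorithm outputs `f A` after `q` queries to `A`, for `A : X → G`
uniformly random; `O A` is the operator performing one query to `A`. -/
def successProb {G : Type*} [Fintype G] (alg : Algorithm X R Z S)
    (O : (X → G) → StateSpace X R Z →ₗ[ℂ] StateSpace X R Z) (f : (X → G) → S) (q : ℕ) : ℝ :=
  (∑ A : X → G, alg.outputProb (O A) q (f A)) / (Fintype.card (X → G) : ℝ)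

end Algorithm

/-- The success probabilities of all `q`-query algorithms, with phase queries to a uniformly random
`A : {0, …, M - 1} → G`, at computing the sum of the values of `A`. -/
def phaseSumProbs (G : Type u) [AddCommGroup G] [Fintype G] (M q : ℕ) : Set ℝ :=
  {p | ∃ (Z : Type u) (_ : Fintype Z) (alg : Algorithm (Fin M) (AddChar G ℂ) Z G),
    p = alg.successProb (fun A : Fin M → G => phaseQuery A) (fun A => ∑ x, A x) q}

/-- The success probabilities of all `q`-query algorithms, with controlled-add queries to a
uniformly random `A : {0, …, M - 1} → G`, at computing the sum of the values of `A`. -/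
def addSumProbs (G : Type u) [AddCommGroup G] [Fintype G] (M q : ℕ) : Set ℝ :=
  {p | ∃ (Z : Type u) (_ : Fintype Z) (alg : Algorithm (Fin M) G Z G),
    p = alg.successProb (fun A : Fin M → G => addQuery A) (fun A => ∑ x, A x) q}

/-- In each of the two query models, the maximum success probability of a `q`-query algorithm at
the summation problem for functions `{0, …, M - 1} → G` exists and is equal to `p`. -/
def IsMaxSumProb (G : Type u) [AddCommGroup G] [Fintype G] (M q : ℕ) (p : ℝ) : Prop :=
  IsGreatest (phaseSumProbs G M q) p ∧ IsGreatest (addSumProbs G M q) p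

end QuantumQuery

end

/-! This is a Fourier argument on the group of functions `X → G`. A query raises the degree of an
amplitude in `A` by at most one, so after `q` queries each amplitude is a combination of characters
`χ` of weight at most `q`. The event that the sum is `s` expands in the diagonal characters `A ↦ η
(∑ x, A x)`, which only correlate the coefficients at `χ` and `χ + η`. Let `n` bound, for every `χ`,
the number of `η` with `χ + η` of weight at most `q`. Then AM-GM and Parseval give success at most
`n / |G|` (`sum_fiber_le`, `successProb_sum_le`).

Conversely, if `χ + η` has weight at most `q` for all `η ∈ s`, then `q` queries give the branches `η
∈ s` of a superposition the phases `χ(A) η(∑ A)`. The factor `χ(A)` is global, and measuring after a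
Fourier transform finds the sum with probability at least `|s| / |G|`
(`exists_algorithm_le_successProb`).

For `q < M`, the optimal `n` is `min (M / (M - q)) |G|`: `χ + η` has weight at most `q` iff `χ`
equals `-η` at `M - q` or more points, and these level sets are disjoint. -/

namespace QuantumQuery

open Finset ComplexConjugate

/-! ### Fourier analysis and degree on `X → G` -/

section Degree

variable {X G : Type*} [Fintype X] [DecidableEq X] [AddCommGroup G] [Fintype G]

/-- The character of `X → G` whose component at `x` is `χ x`. -/
def tupleChar (χ : X → AddChar G ℂ) (A : X → G) : ℂ := ∏ x, χ x (A x)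

/-- The number of nontrivial components of a character of `X → G`. -/
noncomputable def weight (χ : X → AddChar G ℂ) : ℕ := #{x | χ x ≠ 0}

/-- Functions of `A : X → G` that are combinations of characters of weight at most `k`. -/
def degreeLE (X G : Type*) [Fintype X] [DecidableEq X] [AddCommGroup G] [Fintype G] (k : ℕ) :
    Submodule ℂ ((X → G) → ℂ) :=
  Submodule.span ℂ (tupleChar '' {χ | weight χ ≤ k})

omit [DecidableEq X] [Fintype G] in
lemma tupleChar_add (χ χ' : X → AddChar G ℂ) (A : X → G) :
    tupleChar (χ + χ') A = tupleChar χ A * tupleChar χ' A := by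
  simp [tupleChar, prod_mul_distrib]

omit [Fintype G] in
lemma tupleChar_single (x : X) (ξ : AddChar G ℂ) (A : X → G) :
    tupleChar (Pi.single x ξ) A = ξ (A x) := by
  rw [tupleChar, prod_eq_single x]
  · simp
  · intro y _ hy
    simp [hy]
  · simp

omit [DecidableEq X] [Fintype G] in
lemma tupleChar_const (η : AddChar G ℂ) (A : X → G) :
    tupleChar (fun _ => η) A = η (∑ x, A x) := by
  have h := map_prod η.toMonoidHom (fun x => Multiplicative.ofAdd (A x)) univ
  exact h.symm

omit [DecidableEq X] in
lemma conj_tupleChar (χ : X → AddChar G ℂ) (A : X → G) :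
    conj (tupleChar χ A) = tupleChar (-χ) A := by
  simp [tupleChar, AddChar.map_neg_eq_conj]

omit [DecidableEq X] in
lemma norm_tupleChar (χ : X → AddChar G ℂ) (A : X → G) : ‖tupleChar χ A‖ = 1 := by
  simp [tupleChar]

lemma sum_tupleChar (χ : X → AddChar G ℂ) :
    ∑ A, tupleChar χ A = if χ = 0 then (Fintype.card (X → G) : ℂ) else 0 := by
  unfold tupleChar
  rw [← Fintype.prod_sum fun x g => χ x g]
  simp_rw [AddChar.sum_eq_ite]
  split_ifs with h
  · subst h
    simp
  · obtain ⟨x, hx⟩ := Function.ne_iff.1 h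
    exact prod_eq_zero (mem_univ x) (if_neg hx)

omit [Fintype G] in
lemma weight_add_single_le (χ : X → AddChar G ℂ) (x : X) (ξ : AddChar G ℂ) :
    weight (χ + Pi.single x ξ) ≤ weight χ + 1 := by
  refine (card_le_card ?_).trans (card_insert_le x {y | χ y ≠ 0})
  intro y hy
  by_cases h : y = x
  · simp [h]
  · simpa [h] using hy

lemma const_mem_degreeLE (c : ℂ) (k : ℕ) : (fun _ => c) ∈ degreeLE X G k := by
  have h : (fun _ => c) = c • tupleChar (0 : X → AddChar G ℂ) := by
    ext A
    simp [tupleChar]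
  rw [h]
  exact Submodule.smul_mem _ _ (Submodule.subset_span ⟨0, by simp [weight], rfl⟩)

/-- Expanding `u` in characters of `G` changes only the component at `x`, so the weight grows by at
most one. -/
lemma mul_mem_degreeLE {k : ℕ} (u : G → ℂ) (x : X) {f : (X → G) → ℂ} (hf : f ∈ degreeLE X G k) :
    (fun A => u (A x) * f A) ∈ degreeLE X G (k + 1) := by
  induction hf using Submodule.span_induction with
  | mem f hf =>
    obtain ⟨χ, hχ, rfl⟩ := hf
    have hu : u = ∑ ξ, (AddChar.complexBasis G).repr u ξ • (ξ : G → ℂ) := by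
      conv_lhs => rw [← (AddChar.complexBasis G).sum_repr u]
      simp
    have h : (fun A => u (A x) * tupleChar χ A) =
        ∑ ξ, (AddChar.complexBasis G).repr u ξ • tupleChar (χ + Pi.single x ξ) := by
      ext A
      conv_lhs => rw [hu]
      simp only [Finset.sum_apply, Pi.smul_apply, smul_eq_mul, sum_mul, tupleChar_add,
        tupleChar_single]
      exact sum_congr rfl fun ξ _ => by ring
    rw [h]
    refine Submodule.sum_mem _ fun ξ _ => Submodule.smul_mem _ _ (Submodule.subset_span ?_)
    exact ⟨_, (weight_add_single_le χ x ξ).trans (Nat.add_le_add_right hχ 1), rfl⟩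
  | zero =>
    convert (degreeLE X G (k + 1)).zero_mem using 1
    ext A
    simp
  | add f g _ _ hf hg =>
    convert Submodule.add_mem _ hf hg using 1
    ext A
    simp [mul_add]
  | smul c f _ hf =>
    convert Submodule.smul_mem _ c hf using 1
    ext A
    simp [mul_left_comm]

lemma exists_coeff_of_mem_degreeLE {k : ℕ} {f : (X → G) → ℂ} (hf : f ∈ degreeLE X G k) :
    ∃ c : (X → AddChar G ℂ) → ℂ, (∀ χ, k < weight χ → c χ = 0) ∧
      ∀ A, f A = ∑ χ, c χ * tupleChar χ A := by
  induction hf using Submodule.span_induction with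
  | mem f hf =>
    obtain ⟨χ, hχ, rfl⟩ := hf
    refine ⟨Pi.single χ 1, fun χ' h => ?_, fun A => ?_⟩
    · rw [Pi.single_eq_of_ne]
      rintro rfl
      exact absurd hχ h.not_ge
    · simp [Pi.single_apply]
  | zero => exact ⟨0, by simp, by simp⟩
  | add f g _ _ hf hg =>
    obtain ⟨c, hc, hf⟩ := hf
    obtain ⟨d, hd, hg⟩ := hg
    exact ⟨c + d, fun χ h => by simp [hc χ h, hd χ h],
      fun A => by simp [hf, hg, add_mul, sum_add_distrib]⟩
  | smul a f _ hf =>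
    obtain ⟨c, hc, hf⟩ := hf
    exact ⟨a • c, fun χ h => by simp [hc χ h], fun A => by simp [hf, mul_sum, mul_assoc]⟩

/-- Parseval's identity, twisted by the character `A ↦ η (∑ x, A x)`. -/
lemma sum_char_mul_normSq (c : (X → AddChar G ℂ) → ℂ) (η : AddChar G ℂ) :
    ∑ A : X → G, η (∑ x, A x) * (‖∑ χ, c χ * tupleChar χ A‖ ^ 2 : ℝ) =
      Fintype.card (X → G) * ∑ χ, c χ * conj (c (χ + fun _ => η)) := by
  have h (A : X → G) : η (∑ x, A x) * ((‖∑ χ, c χ * tupleChar χ A‖ ^ 2 : ℝ) : ℂ) =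
      ∑ χ, ∑ χ', c χ * conj (c χ') * tupleChar (χ + (fun _ => η) + -χ') A := by
    rw [Complex.ofReal_pow, ← Complex.mul_conj',
      map_sum conj, sum_mul_sum, mul_sum]
    refine sum_congr rfl fun χ _ => ?_
    rw [mul_sum]
    refine sum_congr rfl fun χ' _ => ?_
    rw [map_mul, conj_tupleChar, tupleChar_add, tupleChar_add, tupleChar_const]
    ring
  simp_rw [h]
  rw [sum_comm, mul_sum]
  refine sum_congr rfl fun χ _ => ?_
  rw [sum_comm]
  simp_rw [← mul_sum, sum_tupleChar, add_neg_eq_zero]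
  simp [mul_comm]

/-- Correlations of a family supported on weights at most `k` along the diagonal characters. -/
lemma sum_norm_mul_norm_shift_le {k n : ℕ}
    (hn : ∀ χ : X → AddChar G ℂ, #{η : AddChar G ℂ | weight (χ + fun _ => η) ≤ k} ≤ n)
    (c : (X → AddChar G ℂ) → ℂ) (hc : ∀ χ, k < weight χ → c χ = 0) :
    ∑ η : AddChar G ℂ, ∑ χ, ‖c χ‖ * ‖c (χ + fun _ => η)‖ ≤ n * ∑ χ, ‖c χ‖ ^ 2 := by
  have key : ∑ η : AddChar G ℂ, ∑ χ : X → AddChar G ℂ,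
      (if weight (χ + fun _ => η) ≤ k then ‖c χ‖ ^ 2 else 0) ≤ n * ∑ χ, ‖c χ‖ ^ 2 := by
    rw [sum_comm, mul_sum]
    refine sum_le_sum fun χ _ => ?_
    rw [← sum_filter, sum_const, nsmul_eq_mul]
    exact mul_le_mul_of_nonneg_right (by exact_mod_cast hn χ) (by positivity)
  have key' : ∑ η : AddChar G ℂ, ∑ χ : X → AddChar G ℂ,
      (if weight χ ≤ k then ‖c (χ + fun _ => η)‖ ^ 2 else 0) ≤ n * ∑ χ, ‖c χ‖ ^ 2 := by
    refine le_trans (le_of_eq ?_) key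
    -- Replacing `η` by `-η`, then `χ` by `χ + η`, turns this sum into that of `key`.
    rw [← Equiv.sum_comp (Equiv.neg (AddChar G ℂ))]
    refine sum_congr rfl fun η _ => ?_
    rw [← Equiv.sum_comp (Equiv.addRight (fun _ : X => η))]
    refine sum_congr rfl fun χ _ => ?_
    have h : (χ + (fun _ => η) + fun _ => -η) = χ := by
      ext1 x
      simp
    simp [h]
  -- AM-GM; the product vanishes unless both weights are at most `k`.
  have h (η : AddChar G ℂ) (χ : X → AddChar G ℂ) : ‖c χ‖ * ‖c (χ + fun _ => η)‖ ≤
      ((if weight (χ + fun _ => η) ≤ k then ‖c χ‖ ^ 2 else 0) +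
        (if weight χ ≤ k then ‖c (χ + fun _ => η)‖ ^ 2 else 0)) / 2 := by
    split_ifs with h₁ h₂ h₂
    · nlinarith [sq_nonneg (‖c χ‖ - ‖c (χ + fun _ => η)‖)]
    · rw [hc χ (not_le.1 h₂)]
      simp
    · rw [hc _ (not_le.1 h₁)]
      simp
    · rw [hc χ (not_le.1 h₂)]
      simp
  refine (sum_le_sum fun η _ => sum_le_sum fun χ _ => h η χ).trans ?_
  simp_rw [← sum_div, sum_add_distrib]
  linarith

-- Orthogonality of characters writes the indicator of the fiber as an average of `η (∑ x, A x - s)`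
-- over `η`; the triangle inequality then leaves the diagonal correlations.
open Classical in
lemma sum_fiber_le {k n : ℕ}
    (hn : ∀ χ : X → AddChar G ℂ, #{η : AddChar G ℂ | weight (χ + fun _ => η) ≤ k} ≤ n)
    {f : (X → G) → ℂ} (hf : f ∈ degreeLE X G k) (s : G) :
    ∑ A, (if ∑ x, A x = s then ‖f A‖ ^ 2 else 0) ≤ n / Fintype.card G * ∑ A, ‖f A‖ ^ 2 := by
  obtain ⟨c, hc, hfc⟩ := exists_coeff_of_mem_degreeLE hf
  have hG : (0 : ℝ) < Fintype.card G := by exact_mod_cast Fintype.card_pos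
  have parseval : ∑ A, ‖f A‖ ^ 2 = Fintype.card (X → G) * ∑ χ, ‖c χ‖ ^ 2 := by
    have h := sum_char_mul_normSq c 0
    have h0 (χ : X → AddChar G ℂ) : (χ + fun _ => 0) = χ := by
      ext1 x
      simp
    simp_rw [← hfc, h0, Complex.mul_conj'] at h
    simp only [AddChar.zero_apply, one_mul] at h
    exact_mod_cast h
  have hfib : (Fintype.card G : ℂ) * ((∑ A, if ∑ x, A x = s then ‖f A‖ ^ 2 else 0 : ℝ) : ℂ) =
      ∑ η : AddChar G ℂ, η (-s) *
        (Fintype.card (X → G) * ∑ χ, c χ * conj (c (χ + fun _ => η))) := by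
    simp_rw [← sum_char_mul_normSq, ← hfc, mul_sum]
    rw [sum_comm, Complex.ofReal_sum, mul_sum]
    refine sum_congr rfl fun A _ => ?_
    simp_rw [← mul_assoc, ← AddChar.map_add_eq_mul, ← sum_mul, AddChar.sum_apply_eq_ite,
      neg_add_eq_zero, eq_comm (a := s)]
    split_ifs <;> simp
  have hnorm : (Fintype.card G : ℝ) * (∑ A, if ∑ x, A x = s then ‖f A‖ ^ 2 else 0) ≤
      Fintype.card (X → G) * (n * ∑ χ, ‖c χ‖ ^ 2) := by
    calc _ = ‖(Fintype.card G : ℂ) *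
          ((∑ A, if ∑ x, A x = s then ‖f A‖ ^ 2 else 0 : ℝ) : ℂ)‖ := by
          rw [norm_mul, Complex.norm_natCast, Complex.norm_real, Real.norm_of_nonneg]
          exact sum_nonneg fun A _ => by positivity
      _ ≤ ∑ η : AddChar G ℂ, (Fintype.card (X → G) : ℝ) *
          ∑ χ, ‖c χ‖ * ‖c (χ + fun _ => η)‖ := by
          rw [hfib]
          refine norm_sum_le_of_le _ fun η _ => ?_
          rw [norm_mul, AddChar.norm_apply, one_mul, norm_mul, Complex.norm_natCast]
          refine mul_le_mul_of_nonneg_left (norm_sum_le_of_le _ fun χ _ => ?_) (by positivity)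
          rw [norm_mul, RCLike.norm_conj]
      _ ≤ _ := by
          rw [← mul_sum]
          exact mul_le_mul_of_nonneg_left (sum_norm_mul_norm_shift_le hn c hc) (by positivity)
  rw [parseval, div_mul_eq_mul_div, le_div_iff₀ hG]
  linarith

end Degree

/-! ### Upper bound by the polynomial method -/

section UpperBound

variable {X G R Z : Type*} [Fintype X] [DecidableEq X] [AddCommGroup G] [Fintype G] [Fintype R]
  [Fintype Z]

/-- A query operator that preserves norms and raises the degree of amplitudes in the oracle by at
most one. -/
structure IsDegreeOneQuery (O : (X → G) → StateSpace X R Z →ₗ[ℂ] StateSpace X R Z) : Prop where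
  norm_map (A : X → G) (ψ : StateSpace X R Z) : ‖O A ψ‖ = ‖ψ‖
  mem_degreeLE (k : ℕ) (ψ : (X → G) → StateSpace X R Z)
    (hψ : ∀ i, (fun A => ψ A i) ∈ degreeLE X G k) (i : X × R × Z) :
    (fun A => O A (ψ A) i) ∈ degreeLE X G (k + 1)

lemma isDegreeOneQuery_phaseQuery :
    IsDegreeOneQuery (fun A : X → G => phaseQuery (Z := Z) A) where
  norm_map A ψ := by
    simp [EuclideanSpace.norm_eq, phaseQuery]
  mem_degreeLE k ψ hψ i := mul_mem_degreeLE (i.2.1 : G → ℂ) i.1 (hψ i)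

lemma isDegreeOneQuery_addQuery :
    IsDegreeOneQuery (fun A : X → G => addQuery (Z := Z) A) where
  norm_map A ψ := by
    simp only [EuclideanSpace.norm_eq, addQuery, LinearMap.coe_mk, AddHom.coe_mk,
      Fintype.sum_prod_type]
    congr 1
    refine sum_congr rfl fun x _ => ?_
    exact Equiv.sum_comp (Equiv.subRight (A x)) fun g => ∑ z, ‖ψ (x, g, z)‖ ^ 2
  mem_degreeLE k ψ hψ i := by
    classical
    obtain ⟨x, g, z⟩ := i
    -- The position `g - A x` read off depends on `A`; indicators of its value reduce to fixed
    -- positions.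
    have h : (fun A : X → G => addQuery A (ψ A) (x, g, z)) =
        ∑ h, fun A => (fun a => if g - a = h then (1 : ℂ) else 0) (A x) * ψ A (x, h, z) := by
      ext A
      simp [addQuery]
    rw [h]
    exact Submodule.sum_mem _ fun h _ => mul_mem_degreeLE (fun a => if g - a = h then 1 else 0) x
      (hψ (x, h, z))

namespace Algorithm

variable {S : Type*}

omit [DecidableEq X] in
lemma norm_state (alg : Algorithm X R Z S) {O : StateSpace X R Z →ₗ[ℂ] StateSpace X R Z}
    (hO : ∀ ψ, ‖O ψ‖ = ‖ψ‖) (q : ℕ) : ‖alg.state O q‖ = 1 := by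
  induction q with
  | zero => exact alg.norm_init
  | succ k ih => rw [state, LinearIsometryEquiv.norm_map, hO, ih]

lemma state_mem_degreeLE (alg : Algorithm X R Z S)
    {O : (X → G) → StateSpace X R Z →ₗ[ℂ] StateSpace X R Z} (hO : IsDegreeOneQuery O) (q : ℕ)
    (i : X × R × Z) : (fun A => alg.state (O A) q i) ∈ degreeLE X G q := by
  classical
  induction q generalizing i with
  | zero => exact const_mem_degreeLE (alg.init i) 0
  | succ k ih =>
    have h : (fun A => alg.state (O A) (k + 1) i) =
        ∑ j, alg.gate k (EuclideanSpace.single j 1) i •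
          fun A => O A (alg.state (O A) k) j := by
      ext A
      set v := O A (alg.state (O A) k) with hv
      have hsum : v = ∑ j, v j • EuclideanSpace.single j (1 : ℂ) := by
        ext l
        simp [Pi.single_apply]
      change alg.gate k v i = _
      conv_lhs => rw [hsum]
      simp [mul_comm, ← hv]
    rw [h]
    exact Submodule.sum_mem _ fun j _ => Submodule.smul_mem _ _ (hO.mem_degreeLE k _ ih j)

-- Reconciles the ambient `DecidableEq X` with the classical instance inside `successProb`.
omit [AddCommGroup G] in
lemma successProb_eq (alg : Algorithm X R Z S)
    (O : (X → G) → StateSpace X R Z →ₗ[ℂ] StateSpace X R Z) (f : (X → G) → S) (q : ℕ) :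
    alg.successProb O f q =
      (∑ A : X → G, alg.outputProb (O A) q (f A)) / (Fintype.card (X → G) : ℝ) := by
  obtain rfl : ‹DecidableEq X› = fun a b => Classical.propDecidable (a = b) :=
    Subsingleton.elim _ _
  rfl

lemma successProb_sum_le (alg : Algorithm X R Z G)
    {O : (X → G) → StateSpace X R Z →ₗ[ℂ] StateSpace X R Z} (hO : IsDegreeOneQuery O) {q n : ℕ}
    (hn : ∀ χ : X → AddChar G ℂ, #{η : AddChar G ℂ | weight (χ + fun _ => η) ≤ q} ≤ n) :
    alg.successProb O (fun A => ∑ x, A x) q ≤ n / Fintype.card G := by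
  have hcard : (0 : ℝ) < Fintype.card (X → G) := by exact_mod_cast Fintype.card_pos
  rw [successProb_eq, div_le_iff₀ hcard]
  unfold outputProb
  rw [sum_comm]
  -- The fiber bound applies to each outcome `i` separately, with `s` its decoded output.
  calc _ ≤ ∑ i, (n / Fintype.card G : ℝ) * ∑ A : X → G, ‖alg.state (O A) q i‖ ^ 2 := by
        refine sum_le_sum fun i _ => ?_
        refine le_trans (le_of_eq ?_)
          (sum_fiber_le hn (alg.state_mem_degreeLE hO q i) (alg.out i))
        refine sum_congr rfl fun A _ => ?_
        congr! 1
        exact eq_comm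
    _ = _ := by
        rw [← mul_sum, sum_comm]
        simp_rw [← EuclideanSpace.norm_sq_eq, alg.norm_state (hO.norm_map _)]
        simp

end Algorithm

end UpperBound

/-! ### Optimal algorithms from query eigenstates -/

section LowerBound

/-- In finite dimension, any two orthonormal families with the same index set are related by a
unitary. -/
lemma exists_unitary_map_eq {ι E : Type*} [Fintype ι] [NormedAddCommGroup E]
    [InnerProductSpace ℂ E] [FiniteDimensional ℂ E] {u v : ι → E} (hu : Orthonormal ℂ u)
    (hv : Orthonormal ℂ v) : ∃ U : E ≃ₗᵢ[ℂ] E, ∀ i, U (u i) = v i := by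
  classical
  let b := EuclideanSpace.basisFun ι ℂ
  have isom {w : ι → E} (hw : Orthonormal ℂ w) :
      ∃ T : EuclideanSpace ℂ ι →ₗᵢ[ℂ] E, ∀ i, T (b i) = w i := by
    have hc : Orthonormal ℂ (b.toBasis.constr ℂ w ∘ b.toBasis) := by
      convert hw
      ext i
      simp
    refine ⟨LinearMap.isometryOfOrthonormal _ (v := b.toBasis) (by simp [b.orthonormal]) hc,
      fun i => ?_⟩
    have h := b.toBasis.constr_basis ℂ w i
    rwa [b.coe_toBasis] at h
  obtain ⟨T, hT⟩ := isom hu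
  obtain ⟨T', hT'⟩ := isom hv
  -- An isometry from the span of `u` to `E`; its extension to `E` is onto by finite dimension.
  let L := T'.comp T.equivRange.symm.toLinearIsometry
  refine ⟨L.extend.toLinearIsometryEquiv rfl, fun i => ?_⟩
  have h := L.extend_apply (T.equivRange (b i))
  simpa [L, hT, hT'] using h

section Eigenstates

variable {X R Z S ι : Type*} [Fintype X] [Fintype R] [Fintype Z] [Fintype ι]

/-- An algorithm that carries a uniform superposition through a sequence of orthonormal families.
If these consist of eigenvectors of the query, it accumulates the product of the eigenvalues. -/
lemma exists_algorithm_state_eq {u : ℕ → ι → StateSpace X R Z} (hu : ∀ k, Orthonormal ℂ (u k))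
    {s : Finset ι} (hs : s.Nonempty) (out : X × R × Z → S) :
    ∃ alg : Algorithm X R Z S, alg.out = out ∧
      ∀ (O : StateSpace X R Z →ₗ[ℂ] StateSpace X R Z) (φ : ℕ → ι → ℂ) (q : ℕ),
        (∀ k < q, ∀ i, O (u k i) = φ k i • u k i) →
        alg.state O q = ∑ i ∈ s, ((√(#s : ℝ) : ℂ)⁻¹ * ∏ k ∈ range q, φ k i) • u q i := by
  choose U hU using fun k => exists_unitary_map_eq (hu k) (hu (k + 1))
  have hcard : (0 : ℝ) < #s := by exact_mod_cast hs.card_pos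
  have hnorm : ‖∑ i ∈ s, (√(#s : ℝ) : ℂ)⁻¹ • u 0 i‖ = 1 := by
    rw [← sq_eq_sq₀ (norm_nonneg _) zero_le_one, norm_sq_eq_re_inner (𝕜 := ℂ),
      (hu 0).inner_sum]
    have h : conj (√(#s : ℝ) : ℂ)⁻¹ * (√(#s : ℝ) : ℂ)⁻¹ = ((#s : ℝ)⁻¹ : ℝ) := by
      rw [map_inv₀, Complex.conj_ofReal, ← mul_inv, ← Complex.ofReal_mul,
        Real.mul_self_sqrt hcard.le, Complex.ofReal_inv]
    rw [h, sum_const, nsmul_eq_mul, ← Complex.ofReal_natCast, ← Complex.ofReal_mul,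
      mul_inv_cancel₀ hcard.ne']
    simp
  refine ⟨⟨_, hnorm, U, out⟩, rfl, fun O φ q h => ?_⟩
  induction q with
  | zero => simp [Algorithm.state]
  | succ k ih =>
    rw [Algorithm.state, ih fun j hj => h j (hj.trans k.lt_succ_self)]
    simp only [map_sum, map_smul, h k k.lt_succ_self, hU, smul_smul, prod_range_succ, mul_assoc]

open Classical in
/-- The state `|x⟩ ⊗ w ⊗ |z⟩`. -/
noncomputable def prodState (x : X) (w : R → ℂ) (z : Z) : StateSpace X R Z :=
  WithLp.toLp 2 fun i => if i.1 = x ∧ i.2.2 = z then w i.2.1 else 0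

omit [Fintype ι] in
lemma orthonormal_prodState (x : ι → X) {w : ι → R → ℂ} (hw : ∀ i, ∑ r, ‖w i r‖ ^ 2 = 1)
    {z : ι → Z} (hz : Function.Injective z) :
    Orthonormal ℂ fun i => prodState (x i) (w i) (z i) := by
  classical
  refine ⟨fun i => ?_, fun i j hij => ?_⟩
  · rw [← sq_eq_sq₀ (norm_nonneg _) zero_le_one, EuclideanSpace.norm_sq_eq, one_pow, ← hw i]
    simp only [prodState, Fintype.sum_prod_type]
    rw [Fintype.sum_eq_single (x i) (by simp +contextual)]
    refine sum_congr rfl fun r _ => ?_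
    rw [Fintype.sum_eq_single (z i) (by simp +contextual)]
    simp
  · change inner ℂ (prodState (x i) (w i) (z i)) (prodState (x j) (w j) (z j)) = 0
    rw [PiLp.inner_apply]
    refine sum_eq_zero fun l _ => ?_
    by_cases h : l.2.2 = z i
    · have h' : l.2.2 ≠ z j := fun h' => hij (hz (h.symm.trans h'))
      simp [prodState, h']
    · simp [prodState, h]

variable {G : Type*} [AddCommGroup G] [Fintype G]

open Classical in
/-- The state `|x⟩ ⊗ |r⟩` tensored with the Fourier basis state of the character `η`. -/
noncomputable def fourierState (x : X) (r : R) (η : AddChar G ℂ) : StateSpace X R G :=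
  WithLp.toLp 2 fun i =>
    if i.1 = x ∧ i.2.1 = r then (√(Fintype.card G : ℝ) : ℂ)⁻¹ * η (-i.2.2) else 0

lemma orthonormal_fourierState (x : X) (r : R) :
    Orthonormal ℂ (fourierState x r : AddChar G ℂ → StateSpace X R G) := by
  classical
  rw [orthonormal_iff_ite]
  intro η η'
  have hG : (Fintype.card G : ℂ) ≠ 0 := by exact_mod_cast Fintype.card_ne_zero
  have hs : (√(Fintype.card G : ℝ) : ℂ) * √(Fintype.card G : ℝ) = Fintype.card G := by
    exact_mod_cast Real.mul_self_sqrt (Nat.cast_nonneg (Fintype.card G))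
  rw [PiLp.inner_apply, Fintype.sum_prod_type, Fintype.sum_eq_single x, Fintype.sum_prod_type,
    Fintype.sum_eq_single r]
  · have h (g : G) : inner ℂ (fourierState x r η (x, r, g)) (fourierState x r η' (x, r, g)) =
        (Fintype.card G : ℂ)⁻¹ * (η - η') g := by
      simp only [fourierState, and_self, if_true, RCLike.inner_apply, map_mul, map_inv₀,
        Complex.conj_ofReal, AddChar.sub_apply, ← AddChar.map_neg_eq_conj, neg_neg]
      rw [← hs]
      ring
    simp_rw [h, ← mul_sum, AddChar.sum_eq_ite, sub_eq_zero]
    split_ifs <;> simp [hG]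
  · intro r' hr
    simp [fourierState, hr]
  · intro x' hx
    simp [fourierState, hx]

end Eigenstates

variable {X G R : Type*} [Fintype X] [DecidableEq X] [AddCommGroup G] [Fintype G] [Fintype R]

omit [Fintype X] [DecidableEq X] [Fintype G] in
lemma exists_query_sequence [Nonempty X] (χ : X → AddChar G ℂ) {q : ℕ} (T : Finset X)
    (hT : #T ≤ q) : ∃ p : ℕ → X × AddChar G ℂ,
      ∀ A : X → G, ∏ k ∈ range q, (p k).2 (A (p k).1) = ∏ x ∈ T, χ x (A x) := by
  classical
  induction q generalizing T with
  | zero =>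
    obtain rfl : T = ∅ := by simpa using hT
    exact ⟨fun _ => (Classical.arbitrary X, 0), by simp⟩
  | succ q ih =>
    obtain rfl | ⟨x, hx⟩ := T.eq_empty_or_nonempty
    -- Spare queries use the trivial character, which contributes the factor 1.
    · exact ⟨fun _ => (Classical.arbitrary X, 0), by simp⟩
    · obtain ⟨p, hp⟩ := ih (T.erase x) (by rw [card_erase_of_mem hx]; lia)
      refine ⟨Function.update p q (x, χ x), fun A => ?_⟩
      rw [prod_range_succ, ← prod_erase_mul T _ hx, ← hp A]
      congr 1
      · refine prod_congr rfl fun k hk => ?_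
        rw [Function.update_of_ne (mem_range.1 hk).ne]
      · simp

omit [DecidableEq X] [Fintype G] in
lemma exists_query_sequence_tupleChar [Nonempty X] (χ : X → AddChar G ℂ) {q : ℕ}
    (hχ : weight χ ≤ q) : ∃ p : ℕ → X × AddChar G ℂ,
      ∀ A : X → G, ∏ k ∈ range q, (p k).2 (A (p k).1) = tupleChar χ A := by
  obtain ⟨p, hp⟩ := exists_query_sequence χ {x | χ x ≠ 0} hχ
  refine ⟨p, fun A => (hp A).trans ?_⟩
  refine prod_subset (subset_univ _) fun x _ hx => ?_
  have hx : χ x = 0 := by simpa using hx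
  simp [hx]

/-- Query operators with, for every character `ξ`, a response state `w ξ` on which a query at `x`
acts as multiplication by `ξ (A x)`. -/
def HasQueryEigenstates (O : (X → G) → StateSpace X R G →ₗ[ℂ] StateSpace X R G) : Prop :=
  ∃ w : AddChar G ℂ → R → ℂ, (∀ ξ, ∑ r, ‖w ξ r‖ ^ 2 = 1) ∧
    ∀ A x ξ z, O A (prodState x (w ξ) z) = ξ (A x) • prodState x (w ξ) z

omit [DecidableEq X] in
lemma hasQueryEigenstates_phaseQuery :
    HasQueryEigenstates (fun A : X → G => phaseQuery (Z := G) A) := by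
  classical
  refine ⟨fun ξ r => if r = ξ then 1 else 0, fun ξ => by simp [apply_ite], fun A x ξ z => ?_⟩
  ext ⟨x', r, z'⟩
  simp only [phaseQuery, prodState, LinearMap.coe_mk, AddHom.coe_mk, PiLp.smul_apply, smul_eq_mul]
  split_ifs with h h' <;> simp_all

-- Fourier basis states of the response register diagonalize translation by `A x`.
omit [DecidableEq X] in
lemma hasQueryEigenstates_addQuery :
    HasQueryEigenstates (fun A : X → G => addQuery (Z := G) A) := by
  classical
  refine ⟨fun ξ g => (√(Fintype.card G : ℝ) : ℂ)⁻¹ * ξ (-g), fun ξ => ?_, fun A x ξ z => ?_⟩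
  · simp
  · ext ⟨x', g, z'⟩
    simp only [addQuery, prodState, LinearMap.coe_mk, AddHom.coe_mk, PiLp.smul_apply, smul_eq_mul]
    split_ifs with h
    · rw [h.1, neg_sub, sub_eq_add_neg, AddChar.map_add_eq_mul]
      ring
    · simp

omit [DecidableEq X] in
lemma exists_algorithm_le_successProb [Nonempty X] [Nonempty R]
    {O : (X → G) → StateSpace X R G →ₗ[ℂ] StateSpace X R G} (hO : HasQueryEigenstates O)
    (χ : X → AddChar G ℂ) {s : Finset (AddChar G ℂ)} (hs : s.Nonempty) {q : ℕ}
    (hq : ∀ η ∈ s, weight (χ + fun _ => η) ≤ q) :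
    ∃ alg : Algorithm X R G G,
      (#s / Fintype.card G : ℝ) ≤ alg.successProb O (fun A => ∑ x, A x) q := by
  classical
  obtain ⟨w, hw, hOw⟩ := hO
  let x₀ := Classical.arbitrary X
  let r₀ := Classical.arbitrary R
  -- Work-register labels keep the branches orthogonal even when two of them make the same query.
  let e : AddChar G ℂ ≃ G := Fintype.equivOfCardEq AddChar.card_eq
  have hp (η : AddChar G ℂ) : ∃ p : ℕ → X × AddChar G ℂ, η ∈ s → ∀ A : X → G,
      ∏ k ∈ range q, (p k).2 (A (p k).1) = tupleChar (χ + fun _ => η) A := by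
    by_cases h : η ∈ s
    · obtain ⟨p, hp⟩ := exists_query_sequence_tupleChar _ (hq η h)
      exact ⟨p, fun _ => hp⟩
    · exact ⟨fun _ => (x₀, 0), fun h' => absurd h' h⟩
  choose p hp using hp
  let u (k : ℕ) (η : AddChar G ℂ) : StateSpace X R G :=
    if k < q then prodState (p η k).1 (w (p η k).2) (e η) else fourierState x₀ r₀ η
  have hu (k : ℕ) : Orthonormal ℂ (u k) := by
    by_cases h : k < q
    · simpa only [u, h, if_true] using
        orthonormal_prodState (fun η => (p η k).1) (fun η => hw (p η k).2) e.injective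
    · simpa only [u, h, if_false] using orthonormal_fourierState x₀ r₀
  obtain ⟨alg, hout, hstate⟩ := exists_algorithm_state_eq hu hs fun i => i.2.2
  have hG : (0 : ℝ) < Fintype.card G := by exact_mod_cast Fintype.card_pos
  have hcard : (0 : ℝ) < Fintype.card (X → G) := by exact_mod_cast Fintype.card_pos
  -- At `z = ∑ x, A x` the Fourier amplitude `η (-z)` cancels the accumulated `η (∑ x, A x)`, so all
  -- branches interfere constructively.
  have amplitude (A : X → G) : alg.state (O A) q (x₀, r₀, ∑ x, A x) =
      #s * ((√(#s : ℝ) : ℂ)⁻¹ * (√(Fintype.card G : ℝ) : ℂ)⁻¹) * tupleChar χ A := by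
    rw [hstate (O A) (fun k η => (p η k).2 (A (p η k).1)) q
      (fun k hk η => by simp only [u, hk, if_true, hOw])]
    have hterm (η : AddChar G ℂ) (hη : η ∈ s) :
        ((√(#s : ℝ) : ℂ)⁻¹ * ∏ k ∈ range q, (p η k).2 (A (p η k).1)) *
          u q η (x₀, r₀, ∑ x, A x) =
        (√(#s : ℝ) : ℂ)⁻¹ * (√(Fintype.card G : ℝ) : ℂ)⁻¹ * tupleChar χ A := by
      have hη1 : η (∑ x, A x) * η (-∑ x, A x) = 1 := by
        rw [← AddChar.map_add_eq_mul, add_neg_cancel, AddChar.map_zero_eq_one]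
      rw [hp η hη A, tupleChar_add, tupleChar_const]
      simp only [u, lt_irrefl, if_false, fourierState, and_self, if_true]
      linear_combination (√(#s : ℝ) : ℂ)⁻¹ * (√(Fintype.card G : ℝ) : ℂ)⁻¹ * tupleChar χ A * hη1
    simp only [WithLp.ofLp_sum, WithLp.ofLp_smul, Finset.sum_apply, Pi.smul_apply, smul_eq_mul]
    rw [sum_congr rfl hterm, sum_const, nsmul_eq_mul]
    ring
  refine ⟨alg, ?_⟩
  rw [Algorithm.successProb_eq, le_div_iff₀ hcard]
  calc (#s / Fintype.card G : ℝ) * Fintype.card (X → G)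
      = ∑ A : X → G, (#s / Fintype.card G : ℝ) := by simp [mul_comm]
    _ ≤ _ := by
      refine sum_le_sum fun A _ => ?_
      rw [Algorithm.outputProb, hout]
      refine le_trans (le_of_eq ?_) (single_le_sum (fun i _ => by positivity)
        (mem_univ (x₀, r₀, ∑ x, A x)))
      have hs0 : (0 : ℝ) < #s := by exact_mod_cast hs.card_pos
      rw [if_pos rfl, amplitude]
      simp only [norm_mul, norm_tupleChar, norm_inv, Complex.norm_natCast, Complex.norm_real,
        Real.norm_of_nonneg (Real.sqrt_nonneg _), mul_one, mul_pow, inv_pow,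
        Real.sq_sqrt hs0.le, Real.sq_sqrt hG.le]
      field_simp

end LowerBound

/-! ### Counting diagonal translates of small weight -/

section Maximum

variable {G : Type*} [AddCommGroup G] [Fintype G]

/-- Each counted `η` owns at least `|X| - q` points where `χ = -η`, and distinct `η` own disjoint
sets. -/
lemma card_weight_add_const_le_mul {X : Type*} [Fintype X] (χ : X → AddChar G ℂ) (q : ℕ) :
    #{η : AddChar G ℂ | weight (χ + fun _ => η) ≤ q} * (Fintype.card X - q) ≤ Fintype.card X := by
  classical
  rw [← smul_eq_mul]
  refine (card_nsmul_le_sum _ (fun η => #{x | χ x = -η}) _ fun η hη => ?_).trans ?_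
  · have h : #{x | χ x = -η} + weight (χ + fun _ => η) = Fintype.card X := by
      simp_rw [weight, Pi.add_apply, ← add_eq_zero_iff_eq_neg]
      exact card_filter_add_card_filter_not _
    have hη := (mem_filter.1 hη).2
    lia
  · rw [← card_biUnion]
    · exact card_le_univ _
    · intro η _ η' _ hne
      refine disjoint_left.2 fun x hx hx' => hne ?_
      simp only [mem_filter, mem_univ, true_and] at hx hx'
      exact neg_injective (hx.symm.trans hx')

lemma card_weight_add_const_le {X : Type*} [Fintype X] (χ : X → AddChar G ℂ) {q : ℕ}
    (hq : q < Fintype.card X) :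
    #{η : AddChar G ℂ | weight (χ + fun _ => η) ≤ q} ≤
      min (Fintype.card X / (Fintype.card X - q)) (Fintype.card G) := by
  refine le_min ?_ ?_
  · exact (Nat.le_div_iff_mul_le (by lia)).2 (card_weight_add_const_le_mul χ q)
  · exact (card_le_univ _).trans AddChar.card_eq.le

lemma exists_weight_add_const_le {M q n : ℕ} (hq : q < M) (hM : n ≤ M / (M - q))
    (hG : n ≤ Fintype.card G) :
    ∃ (χ : Fin M → AddChar G ℂ) (s : Finset (AddChar G ℂ)), #s = n ∧
      ∀ η ∈ s, weight (χ + fun _ => η) ≤ q := by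
  classical
  obtain ⟨m, hm⟩ : ∃ m, m = M - q := ⟨_, rfl⟩
  obtain ⟨s, hs⟩ := exists_subset_card_eq (s := (univ : Finset (AddChar G ℂ))) (n := n)
    (by rwa [card_univ, AddChar.card_eq])
  let e : Fin n ≃ s := (finCongr hs.2.symm).trans s.equivFin.symm
  -- `χ` is constant on `n` consecutive blocks of length `m = M - q`, with one value `-η` per block;
  -- points beyond them are irrelevant.
  refine ⟨fun x => if h : x.1 / m < n then -(e ⟨x.1 / m, h⟩ : AddChar G ℂ) else 0, s, hs.2,
    fun η hη => ?_⟩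
  obtain ⟨i, hi⟩ : ∃ i, e i = ⟨η, hη⟩ := e.surjective _
  have hiM : (i.1 + 1) * m ≤ M :=
    (Nat.le_div_iff_mul_le (by lia)).1 ((Nat.succ_le_of_lt i.2).trans (hm ▸ hM))
  let f (j : Fin m) : Fin M := ⟨i.1 * m + j.1, by have := j.2; nlinarith⟩
  have hf : Function.Injective f := by
    intro j j' h
    have h := congrArg Fin.val h
    exact Fin.ext (Nat.add_left_cancel h)
  refine (card_le_card (t := univ \ univ.image f) fun x hx => ?_).trans ?_
  · simp only [mem_sdiff, mem_univ, true_and, mem_image, not_exists]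
    rintro j rfl
    have hdiv : (f j).1 / m = i.1 := by
      change (i.1 * m + j.1) / m = i.1
      rw [mul_comm, Nat.mul_add_div (by lia), Nat.div_eq_of_lt j.2, add_zero]
    simp [hdiv, hi] at hx
  · rw [card_sdiff_of_subset (subset_univ _), card_image_of_injective _ hf, card_univ, card_univ,
      Fintype.card_fin, Fintype.card_fin]
    lia

/-- The maximum is `n / |G|` if `n` is the largest size of a set of diagonal characters that some
translation moves into weight at most `q`. -/
lemma isMaxSumProb_of_weight {G : Type u} [AddCommGroup G] [Fintype G] {M q n : ℕ} (hM : 0 < M)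
    (hn0 : 0 < n)
    (hle : ∀ χ : Fin M → AddChar G ℂ, #{η : AddChar G ℂ | weight (χ + fun _ => η) ≤ q} ≤ n)
    (hex : ∃ (χ : Fin M → AddChar G ℂ) (s : Finset (AddChar G ℂ)), #s = n ∧
      ∀ η ∈ s, weight (χ + fun _ => η) ≤ q) :
    IsMaxSumProb G M q (n / Fintype.card G) := by
  obtain ⟨χ, s, rfl, hs⟩ := hex
  have : Nonempty (Fin M) := ⟨⟨0, hM⟩⟩
  refine ⟨⟨?_, ?_⟩, ⟨?_, ?_⟩⟩
  · obtain ⟨alg, h⟩ := exists_algorithm_le_successProb hasQueryEigenstates_phaseQuery χ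
      (card_pos.1 hn0) hs
    exact ⟨G, _, alg, le_antisymm h (alg.successProb_sum_le isDegreeOneQuery_phaseQuery hle)⟩
  · rintro _ ⟨Z, _, alg, rfl⟩
    exact alg.successProb_sum_le isDegreeOneQuery_phaseQuery hle
  · obtain ⟨alg, h⟩ := exists_algorithm_le_successProb hasQueryEigenstates_addQuery χ
      (card_pos.1 hn0) hs
    exact ⟨G, _, alg, le_antisymm h (alg.successProb_sum_le isDegreeOneQuery_addQuery hle)⟩
  · rintro _ ⟨Z, _, alg, rfl⟩
    exact alg.successProb_sum_le isDegreeOneQuery_addQuery hle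

lemma isMaxSumProb_of_lt (G : Type u) [AddCommGroup G] [Fintype G] {M q : ℕ} (hq : q < M) :
    IsMaxSumProb G M q
      ((min (M / (M - q)) (Fintype.card G) : ℕ) / Fintype.card G) := by
  refine isMaxSumProb_of_weight (by lia)
    (lt_min (Nat.div_pos (Nat.sub_le M q) (by lia)) Fintype.card_pos) (fun χ => ?_)
    (exists_weight_add_const_le hq (min_le_left _ _) (min_le_right _ _))
  simpa using card_weight_add_const_le χ (q := q) (by simpa using hq)

lemma isMaxSumProb_of_le (G : Type u) [AddCommGroup G] [Fintype G] {M q : ℕ} (hM : 0 < M)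
    (hq : M ≤ q) : IsMaxSumProb G M q 1 := by
  have hG : (Fintype.card G : ℝ) ≠ 0 := by exact_mod_cast Fintype.card_ne_zero
  rw [← div_self hG]
  refine isMaxSumProb_of_weight hM Fintype.card_pos
    (fun χ => (card_le_univ _).trans AddChar.card_eq.le) ⟨0, univ, AddChar.card_eq, fun η _ => ?_⟩
  exact (card_le_univ _).trans (by simpa using hq)

lemma floor_div_sub_eq {M q : ℕ} (hq : q < M) :
    (⌊(M : ℝ) / ((M : ℝ) - (q : ℝ))⌋ : ℝ) = (M / (M - q) : ℕ) := by
  rw [← Nat.cast_sub hq.le, ← natCast_floor_eq_intCast_floor (by positivity),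
    Nat.floor_div_eq_div]

end Maximum

end QuantumQuery

theorem theorem5p1 (G : Type u) [AddCommGroup G] [Fintype G] (M q : ℕ) (hM : 0 < M) :
    (q < M → QuantumQuery.IsMaxSumProb G M q
      (min ((⌊(M : ℝ) / ((M : ℝ) - (q : ℝ))⌋ : ℝ) / (Fintype.card G : ℝ)) 1)) ∧
    (M ≤ q → QuantumQuery.IsMaxSumProb G M q 1) ∧
    (Fintype.card G = 2 → 2 * q < M → QuantumQuery.IsMaxSumProb G M q (1 / 2)) ∧
    (Fintype.card G = 2 → M ≤ 2 * q → QuantumQuery.IsMaxSumProb G M q 1) := by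
  refine ⟨fun hq => ?_, QuantumQuery.isMaxSumProb_of_le G hM, fun hG hq => ?_, fun hG hq => ?_⟩
  · have hG : (0 : ℝ) < Fintype.card G := by exact_mod_cast Fintype.card_pos
    have h := QuantumQuery.isMaxSumProb_of_lt G hq
    rwa [Nat.cast_min, ← min_div_div_right hG.le, div_self hG.ne',
      ← QuantumQuery.floor_div_sub_eq hq] at h
  · have h := QuantumQuery.isMaxSumProb_of_lt G (M := M) (q := q) (by lia)
    -- Here `M < 2 * (M - q)`.
    have hdiv : M / (M - q) = 1 := by
      rw [Nat.div_eq_iff (by lia)]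
      lia
    simpa [hdiv, hG] using h
  · obtain hqM | hqM := lt_or_ge q M
    · have h := QuantumQuery.isMaxSumProb_of_lt G hqM
      -- Two blocks of length `M - q` fit, so the cap `|G| = 2` is reached.
      have hdiv : 2 ≤ M / (M - q) := (Nat.le_div_iff_mul_le (by lia)).2 (by lia)
      simpa [hG, min_eq_right hdiv] using h
    · exact QuantumQuery.isMaxSumProb_of_le G hM hqM
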